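/- Let $K$ be an arbitrary field (of any characteristic) and let $K\langle x,y,z\rangle$ be the free associative unital algebra over $K$ with free generators $x,y,z$. Let $u,v\in K\langle x,y,z\rangle$ with $(u,v)\neq(0,0)$ be such that every monomial (word in $x,y,z$) occurring with nonzero coefficient in $u$ or in $v$ contains both the letter $x$ and the letter $y$. Then the $K$-algebra endomorphism $\varphi$ of $K\langle x,y,z\rangle$ determined by \[ \varphi(x)=x+u,\qquad \varphi(y)=y+v,\qquad \varphi(z)=z \] is not an automorphism of $K\langle x,y,z\rangle$. -/

import Mathlib

/-- The free associative algebra `K⟨x, y, z⟩`. -/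
abbrev FreeAlg3 (K : Type*) [Field K] : Type _ := FreeAlgebra K (Fin 3)

namespace FreeAlg3

/-- The free generator `x`. -/
noncomputable def x (K : Type*) [Field K] : FreeAlg3 K := FreeAlgebra.ι K 0

/-- The free generator `y`. -/
noncomputable def y (K : Type*) [Field K] : FreeAlg3 K := FreeAlgebra.ι K 1

/-- The free generator `z`. -/
noncomputable def z (K : Type*) [Field K] : FreeAlg3 K := FreeAlgebra.ι K 2

/-- The monomials of `f`: the words in the letters `0, 1, 2` (standing for `x, y, z`) that occur
in `f` with a nonzero coefficient. -/
noncomputable def monomials {K : Type*} [Field K] (f : FreeAlg3 K) :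
    Finset (FreeMonoid (Fin 3)) :=
  (FreeAlgebra.equivMonoidAlgebraFreeMonoid f).coeff.support

/-- Every monomial of `f` depends on both `x` and `y`. -/
def MonomialsInvolveXY {K : Type*} [Field K] (f : FreeAlg3 K) : Prop :=
  ∀ w ∈ monomials f, (0 : Fin 3) ∈ w.toList ∧ (1 : Fin 3) ∈ w.toList

/-- The `z`-endomorphism `(f, g)` of `K⟨x, y, z⟩`: the `K`-algebra endomorphism with
`x ↦ f`, `y ↦ g`, `z ↦ z`. -/
noncomputable def zEndo {K : Type*} [Field K] (f g : FreeAlg3 K) : FreeAlg3 K →ₐ[K] FreeAlg3 K :=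
  FreeAlgebra.lift K ![f, g, z K]

/-- An endomorphism is an automorphism if it is (the underlying map of) an algebra
isomorphism of the algebra with itself. -/
def IsAutomorphism {K : Type*} [Field K] (φ : FreeAlg3 K →ₐ[K] FreeAlg3 K) : Prop :=
  ∃ e : FreeAlg3 K ≃ₐ[K] FreeAlg3 K, (e : FreeAlg3 K →ₐ[K] FreeAlg3 K) = φ

end FreeAlg3

/-! The generator z is absorbed into the scalars. Let L = K(t₀, t₁, …) with shift σ : tᵢ ↦ tᵢ₊₁, and
let both letters of the skew free algebra over L satisfy Xa = σ(a)X, Ya = σ(a)Y. Sending x, y, z to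
X, Y, t₀ embeds K⟨x,y,z⟩ (`lift_letters_ne_zero`), and z gets bidegree 0. It remains to see that X
and Y do not both lie in the K-algebra generated by f = X + U, g = Y + V and t₀ (`not_generate`).

Take bidegrees of the words of U relative to X and of V relative to Y, and let (a, b) be one of
greatest slope. For the order on bidegrees (p, q) by aq - bp, then by p + q, the leading forms of f
and g have bidegrees (1,0) + s and (0,1) + r, with s, r on the line through (a, b) and not both
zero. The determinant of these bidegrees is 1 + s₁ + r₂ > 0, so they are not proportional.

Two nonzero bihomogeneous elements of non-proportional bidegrees generate a free algebra
(`linearIndependent_evalWord`). This is a Euclidean algorithm: either the pair is left independent,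
or the longer element is a left multiple cg of the shorter one g, and (c, g) is a smaller pair with
the same determinant. Freeness over K survives adjoining t₀ (`linearIndependent_lift_letters`). So
leading forms never cancel, and a word lying in the subalgebra has as bidegree an ℕ-combination of
those two (`exists_monomial_degree_eq`). For X and Y this forces s = r = 0, a contradiction. -/

namespace FreeAlg3

/-! ### Words in two letters -/

/-- The numbers of occurrences of the two letters in a word. -/
def bideg (w : FreeMonoid (Fin 2)) : ℕ × ℕ := (w.toList.count 0, w.toList.count 1)

@[simp]
lemma bideg_one : bideg 1 = 0 := rfl

@[simp]
lemma bideg_mul (v w : FreeMonoid (Fin 2)) : bideg (v * w) = bideg v + bideg w := by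
  simp [bideg, FreeMonoid.toList_mul, List.count_append]

@[simp]
lemma bideg_of_zero : bideg (FreeMonoid.of 0) = (1, 0) := rfl

@[simp]
lemma bideg_of_one : bideg (FreeMonoid.of 1) = (0, 1) := rfl

lemma length_eq_bideg (w : FreeMonoid (Fin 2)) : w.length = (bideg w).1 + (bideg w).2 := by
  induction w using FreeMonoid.inductionOn' with
  | one => rfl
  | of_mul b a ih =>
    fin_cases b <;> simp [FreeMonoid.length_mul, ih, Prod.fst_add, Prod.snd_add] <;> omega

lemma eq_of_mul_eq_mul_of_length {α : Type*} {a b c d : FreeMonoid α} (h : a * b = c * d)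
    (hl : b.length = d.length) : a = c ∧ b = d :=
  List.append_inj' h hl

lemma exists_eq_mul_of_length_le {α : Type*} (w : FreeMonoid α) {n : ℕ} (h : n ≤ w.length) :
    ∃ t s : FreeMonoid α, w = t * s ∧ s.length = n :=
  ⟨FreeMonoid.ofList (w.toList.take (w.length - n)),
    FreeMonoid.ofList (w.toList.drop (w.length - n)),
    (List.take_append_drop _ _).symm, by
      change (List.drop _ w.toList).length = n
      rw [List.length_drop]
      change w.length - _ = n
      omega⟩

/-- The substitution `X ↦ XY`, `Y ↦ Y` on words. -/
def wordSubst : FreeMonoid (Fin 2) →* FreeMonoid (Fin 2) :=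
  FreeMonoid.lift ![FreeMonoid.of 0 * FreeMonoid.of 1, FreeMonoid.of 1]

/-- The first letter of the image is the first letter of the word, so words can be decoded from the
left. -/
lemma wordSubst_injective : Function.Injective wordSubst := by
  intro v
  induction v using FreeMonoid.inductionOn' with
  | one =>
    intro w h
    cases w using FreeMonoid.casesOn with
    | one => rfl
    | of_mul b w =>
      exfalso
      have := congrArg FreeMonoid.length h
      fin_cases b <;> simp [wordSubst, FreeMonoid.length_mul] at this <;> omega
  | of_mul b v ih =>
    intro w h
    cases w using FreeMonoid.casesOn with
    | one =>
      exfalso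
      have := congrArg FreeMonoid.length h
      fin_cases b <;> simp [wordSubst, FreeMonoid.length_mul] at this
    | of_mul c w =>
      rw [map_mul, map_mul] at h
      have hb : b = c := by
        have := congrArg (fun l => l.toList.head?) h
        fin_cases b <;> fin_cases c <;> simp [wordSubst, FreeMonoid.toList_mul] at this ⊢
      subst hb
      rw [ih (mul_left_cancel h)]

/-! ### The skew free algebra -/

section SkewFree

lemma mul_of_ne (v w : FreeMonoid (Fin 2)) {i j : Fin 2} (h : i ≠ j) :
    v * FreeMonoid.of i ≠ w * FreeMonoid.of j := fun e =>
  h (FreeMonoid.of_injective (eq_of_mul_eq_mul_of_length e rfl).2)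

variable {L : Type*} [Field L]

/-- The skew free algebra in two letters over `L`. -/
abbrev SkewFree (L : Type*) [Field L] : Type _ := SkewMonoidAlgebra L (FreeMonoid (Fin 2))

lemma exists_coeff_ne_zero {f : SkewFree L} (hf : f ≠ 0) : ∃ w, f.coeff w ≠ 0 := by
  by_contra! h
  exact hf (SkewMonoidAlgebra.ext h)

/-- Splitting is by the last letter because scalars stand on the left: a combination of words in f,
g then becomes a + Pf + Qg. -/
lemma exists_eq_single_add_mapDomain (l : FreeMonoid (Fin 2) →₀ L) :
    ∃ (a : L) (l₀ l₁ : FreeMonoid (Fin 2) →₀ L), l = Finsupp.single 1 a +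
      l₀.mapDomain (· * FreeMonoid.of 0) + l₁.mapDomain (· * FreeMonoid.of 1) := by
  induction l using Finsupp.induction_linear with
  | zero => exact ⟨0, 0, 0, by simp⟩
  | add p q hp hq =>
    obtain ⟨a, p₀, p₁, hp⟩ := hp
    obtain ⟨b, q₀, q₁, hq⟩ := hq
    refine ⟨a + b, p₀ + q₀, p₁ + q₁, ?_⟩
    rw [hp, hq, Finsupp.mapDomain_add, Finsupp.mapDomain_add, Finsupp.single_add]
    abel
  | single w a =>
    by_cases hw : w.length = 0
    · refine ⟨a, 0, 0, ?_⟩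
      rw [FreeMonoid.length_eq_zero.1 hw]
      simp
    · obtain ⟨t, s, rfl, hs⟩ := exists_eq_mul_of_length_le w (Nat.one_le_iff_ne_zero.2 hw)
      obtain ⟨i, rfl⟩ := FreeMonoid.length_eq_one.1 hs
      fin_cases i
      · exact ⟨0, Finsupp.single t a, 0, by simp⟩
      · exact ⟨0, 0, Finsupp.single t a, by simp⟩

/-- All words of `f` have bidegree `d`. -/
def IsBihomogeneous (f : SkewFree L) (d : ℕ × ℕ) : Prop := ∀ w, f.coeff w ≠ 0 → bideg w = d

lemma IsBihomogeneous.length {f : SkewFree L} {d : ℕ × ℕ} (hf : IsBihomogeneous f d) :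
    ∀ w, f.coeff w ≠ 0 → w.length = d.1 + d.2 := fun w hw => by
  rw [length_eq_bideg, hf w hw]

lemma IsBihomogeneous.coeff_one {f : SkewFree L} {d : ℕ × ℕ} (hf : IsBihomogeneous f d)
    (hd : d ≠ 0) : f.coeff 1 = 0 := by
  by_contra h
  exact hd (hf 1 h).symm

variable [MulSemiringAction (FreeMonoid (Fin 2)) L]

lemma smul_ne_zero_of_ne_zero (w : FreeMonoid (Fin 2)) {a : L} (h : a ≠ 0) : w • a ≠ 0 :=
  (map_ne_zero (MulSemiringAction.toRingHom (FreeMonoid (Fin 2)) L w)).2 h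

lemma word_smul_injective (w : FreeMonoid (Fin 2)) : Function.Injective (w • · : L → L) :=
  (MulSemiringAction.toRingHom (FreeMonoid (Fin 2)) L w).injective

lemma exists_of_coeff_mul_ne_zero {f g : SkewFree L} {w : FreeMonoid (Fin 2)}
    (h : (f * g).coeff w ≠ 0) : ∃ a b, f.coeff a ≠ 0 ∧ g.coeff b ≠ 0 ∧ w = a * b := by
  classical
  have := SkewMonoidAlgebra.support_mul f g (SkewMonoidAlgebra.mem_support_iff.2 h)
  obtain ⟨a, ha, b, hb, rfl⟩ := Finset.mem_mul.1 this
  exact ⟨a, b, SkewMonoidAlgebra.mem_support_iff.1 ha, SkewMonoidAlgebra.mem_support_iff.1 hb, rfl⟩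

/-- A word has only one suffix of length n, so a single product contributes to the convolution. -/
lemma coeff_mul_of_length {f : SkewFree L} {n : ℕ} (hf : ∀ w, f.coeff w ≠ 0 → w.length = n)
    (P : SkewFree L) (r : FreeMonoid (Fin 2)) {v : FreeMonoid (Fin 2)} (hv : v.length = n) :
    (P * f).coeff (r * v) = P.coeff r * r • f.coeff v := by
  classical
  rw [SkewMonoidAlgebra.coeff_mul, SkewMonoidAlgebra.sum_def, Finsupp.sum]
  simp only [SkewMonoidAlgebra.sum_def, Finsupp.sum]
  rw [Finset.sum_eq_single r, Finset.sum_eq_single v]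
  · simp
  · intro b hb hbv
    rw [if_neg]
    exact fun h => hbv (mul_left_cancel h)
  · intro h
    simp [Finsupp.notMem_support_iff.1 h]
  · intro a _ har
    refine Finset.sum_eq_zero fun b hb => if_neg fun h => har ?_
    exact (eq_of_mul_eq_mul_of_length h ((hf b (Finsupp.mem_support_iff.1 hb)).trans hv.symm)).1
  · intro h
    simp [Finsupp.notMem_support_iff.1 h]

lemma mul_ne_zero_of_length {f : SkewFree L} {n : ℕ} (hf : ∀ w, f.coeff w ≠ 0 → w.length = n)
    {P : SkewFree L} (hP : P ≠ 0) (hf0 : f ≠ 0) : P * f ≠ 0 := by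
  obtain ⟨r, hr⟩ := exists_coeff_ne_zero hP
  obtain ⟨v, hv⟩ := exists_coeff_ne_zero hf0
  intro h
  have := coeff_mul_of_length hf P r (hf v hv)
  rw [h] at this
  exact mul_ne_zero hr (smul_ne_zero_of_ne_zero r hv) (by simpa using this.symm)

/-- If `Sf` and `Sg` intersect nontrivially and `f`, `g` are homogeneous, then the longer one is a
left multiple of the shorter one. -/
lemma exists_left_factor {f g P Q : SkewFree L} {d e : ℕ}
    (hf : ∀ w, f.coeff w ≠ 0 → w.length = d) (hg : ∀ w, g.coeff w ≠ 0 → w.length = e)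
    (hed : e ≤ d) (hg0 : g ≠ 0) (hPQ : P ≠ 0 ∨ Q ≠ 0) (h : P * f + Q * g = 0) :
    ∃ c : SkewFree L, f = c * g ∧
      ∀ w, c.coeff w ≠ 0 → ∃ s, f.coeff (w * s) ≠ 0 ∧ g.coeff s ≠ 0 := by
  have hP : P ≠ 0 := by
    rintro rfl
    rw [zero_mul, zero_add] at h
    exact mul_ne_zero_of_length hg (by simpa using hPQ) hg0 h
  obtain ⟨r, hr⟩ := exists_coeff_ne_zero hP
  obtain ⟨s₀, hs₀⟩ := exists_coeff_ne_zero hg0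
  -- The formula is forced: it is f = cg read at the word t * s₀.
  let c : SkewFree L := ⟨Finsupp.onFinset
    ((f.coeff.comapDomain (· * s₀) (mul_left_injective s₀).injOn).support)
    (fun t => f.coeff (t * s₀) * t • (g.coeff s₀)⁻¹) (fun t ht => by
      simpa using left_ne_zero_of_mul ht)⟩
  have hc : ∀ t, c.coeff t = f.coeff (t * s₀) * t • (g.coeff s₀)⁻¹ := fun t => rfl
  refine ⟨c, ?_, fun w hw => ⟨s₀, left_ne_zero_of_mul (hc w ▸ hw), hs₀⟩⟩
  refine SkewMonoidAlgebra.ext fun w => ?_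
  by_cases hw : e ≤ w.length
  · obtain ⟨t, s, rfl, hs⟩ := exists_eq_mul_of_length_le w hw
    rw [coeff_mul_of_length hg c t hs, hc]
    have hss : s₀.length = s.length := (hg s₀ hs₀).trans hs.symm
    by_cases hts : (t * s).length = d
    -- This is Pf + Qg = 0 read at r * t * s. Eliminating the coefficient of Q at r * t between s
    -- and s₀ gives the identity for c after acting by r, which is injective.
    · have key : ∀ s : FreeMonoid (Fin 2), s.length = e → (t * s).length = d →
          P.coeff r * r • f.coeff (t * s) + Q.coeff (r * t) * (r * t) • g.coeff s = 0 := by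
        intro s hs hts
        rw [← coeff_mul_of_length hf P r hts, ← coeff_mul_of_length hg Q (r * t) hs, ← mul_assoc,
          ← Finsupp.add_apply, ← SkewMonoidAlgebra.coeff_add, h]
        rfl
      have h1 := key s hs hts
      have h2 := key s₀ (hg s₀ hs₀) (by rw [← hts, FreeMonoid.length_mul, FreeMonoid.length_mul, hss])
      have hB : (r * t) • g.coeff s₀ ≠ 0 := smul_ne_zero_of_ne_zero _ hs₀
      apply word_smul_injective r
      simp only [smul_mul', smul_inv'', ← mul_smul]
      field_simp
      apply mul_left_cancel₀ hr
      linear_combination (r * t) • g.coeff s₀ * h1 - (r * t) • g.coeff s * h2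
    · have h1 : f.coeff (t * s) = 0 := by
        by_contra h
        exact hts (hf _ h)
      have h2 : f.coeff (t * s₀) = 0 := by
        by_contra h
        refine hts ?_
        rw [← hf _ h, FreeMonoid.length_mul, FreeMonoid.length_mul, hss]
      rw [h1, h2, zero_mul, zero_mul]
  · have h1 : f.coeff w = 0 := by
      by_contra h
      exact hw (hed.trans (hf _ h).ge)
    have h2 : (c * g).coeff w = 0 := by
      by_contra h
      obtain ⟨a, b, -, hb, rfl⟩ := exists_of_coeff_mul_ne_zero h
      apply hw
      rw [FreeMonoid.length_mul, hg b hb]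
      omega
    rw [h1, h2]

/-- The value of a word at a pair of elements. -/
noncomputable abbrev evalWord (f g : SkewFree L) : FreeMonoid (Fin 2) →* SkewFree L := FreeMonoid.lift ![f, g]

lemma linearCombination_mapDomain_mul (f g : SkewFree L) (i : Fin 2)
    (l : FreeMonoid (Fin 2) →₀ L) :
    Finsupp.linearCombination L (evalWord f g) (l.mapDomain (· * FreeMonoid.of i)) =
      Finsupp.linearCombination L (evalWord f g) l * ![f, g] i := by
  rw [Finsupp.linearCombination_mapDomain, Finsupp.linearCombination_apply,
    Finsupp.linearCombination_apply, Finsupp.sum, Finsupp.sum, Finset.sum_mul]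
  exact Finset.sum_congr rfl fun w _ => by
    rw [Function.comp_apply, map_mul, smul_mul_assoc, FreeMonoid.lift_eval_of]

/-- A vanishing combination reads a + Pf + Qg = 0. Here a = 0 because f and g have no constant term,
and P, Q are values of shorter combinations, so induction on length applies. -/
lemma linearIndependent_evalWord_of_left_free {f g : SkewFree L}
    (hf : f.coeff 1 = 0) (hg : g.coeff 1 = 0)
    (h : ∀ P Q : SkewFree L, P * f + Q * g = 0 → P = 0 ∧ Q = 0) :
    LinearIndependent L (evalWord f g) := by
  have key : ∀ n : ℕ, ∀ l : FreeMonoid (Fin 2) →₀ L, (∀ w, l w ≠ 0 → w.length < n) →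
      Finsupp.linearCombination L (evalWord f g) l = 0 → l = 0 := by
    intro n
    induction n with
    | zero =>
      intro l hl _
      ext w
      by_contra hw
      exact absurd (hl w hw) (Nat.not_lt_zero _)
    | succ n ih =>
      intro l hl h0
      obtain ⟨a, l₀, l₁, rfl⟩ := exists_eq_single_add_mapDomain l
      have e0 : ∀ w, (Finsupp.single 1 a + l₀.mapDomain (· * FreeMonoid.of 0) +
          l₁.mapDomain (· * FreeMonoid.of 1) : FreeMonoid (Fin 2) →₀ L)
            (w * FreeMonoid.of 0) = l₀ w := by
        intro w
        rw [Finsupp.add_apply, Finsupp.add_apply, Finsupp.single_eq_of_ne,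
          Finsupp.mapDomain_apply (mul_left_injective _), Finsupp.mapDomain_of_notMem_range]
        · simp
        · rintro ⟨v, hv⟩
          exact mul_of_ne _ _ (by decide) hv
        · intro hw
          have := congrArg FreeMonoid.length hw
          simp at this
      have e1 : ∀ w, (Finsupp.single 1 a + l₀.mapDomain (· * FreeMonoid.of 0) +
          l₁.mapDomain (· * FreeMonoid.of 1) : FreeMonoid (Fin 2) →₀ L)
            (w * FreeMonoid.of 1) = l₁ w := by
        intro w
        rw [Finsupp.add_apply, Finsupp.add_apply, Finsupp.single_eq_of_ne,
          Finsupp.mapDomain_of_notMem_range, Finsupp.mapDomain_apply (mul_left_injective _)]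
        · simp
        · rintro ⟨v, hv⟩
          exact mul_of_ne _ _ (by decide) hv
        · intro hw
          have := congrArg FreeMonoid.length hw
          simp at this
      rw [map_add, map_add, linearCombination_mapDomain_mul, linearCombination_mapDomain_mul,
        Finsupp.linearCombination_single, map_one] at h0
      simp only [Matrix.cons_val_zero, Matrix.cons_val_one] at h0
      have hz : ∀ (P k : SkewFree L), k.coeff 1 = 0 → (P * k).coeff 1 = 0 := by
        intro P k hk
        by_contra hne
        obtain ⟨u, v, -, hv, huv⟩ := exists_of_coeff_mul_ne_zero hne
        have : v = 1 := by
          have := congrArg FreeMonoid.length huv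
          rw [FreeMonoid.length_mul, FreeMonoid.length_one] at this
          exact FreeMonoid.length_eq_zero.1 (by omega)
        exact hv (this ▸ hk)
      have ha : a = 0 := by
        have := congrArg (fun s : SkewFree L => s.coeff 1) h0
        simpa [hz _ _ hf, hz _ _ hg] using this
      subst ha
      rw [zero_smul, zero_add] at h0
      obtain ⟨h1, h2⟩ := h _ _ h0
      rw [ih l₀ (fun w hw => ?_) h1, ih l₁ (fun w hw => ?_) h2]
      · simp
      · have := hl (w * FreeMonoid.of 1) (by rwa [e1])
        simp only [FreeMonoid.length_mul, FreeMonoid.length_of] at this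
        omega
      · have := hl (w * FreeMonoid.of 0) (by rwa [e0])
        simp only [FreeMonoid.length_mul, FreeMonoid.length_of] at this
        omega
  rw [linearIndependent_iff]
  intro l hl
  refine key (l.support.sup FreeMonoid.length + 1) l (fun w hw => ?_) hl
  exact Nat.lt_succ_of_le (Finset.le_sup (f := FreeMonoid.length) (Finsupp.mem_support_iff.2 hw))

/-- Words in cg and g are the words in c and g obtained by the substitution X ↦ XY, Y ↦ Y. -/
lemma linearIndependent_evalWord_mul {c g : SkewFree L}
    (h : LinearIndependent L (evalWord c g)) : LinearIndependent L (evalWord (c * g) g) := by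
  have e : evalWord (c * g) g = (evalWord c g).comp wordSubst := by
    apply FreeMonoid.hom_eq
    intro i
    fin_cases i <;> simp [wordSubst]
  rw [e]
  exact h.comp _ wordSubst_injective

lemma linearIndependent_evalWord_swap {f g : SkewFree L}
    (h : LinearIndependent L (evalWord f g)) : LinearIndependent L (evalWord g f) := by
  have e : evalWord g f = (evalWord f g).comp (FreeMonoid.map (Equiv.swap (0 : Fin 2) 1)) := by
    apply FreeMonoid.hom_eq
    intro i
    fin_cases i <;> simp
  rw [e]
  exact h.comp _ (List.map_injective_iff.2 (Equiv.injective _))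

/-- A pair of nonzero bihomogeneous elements whose bidegrees are not proportional generates a
free subalgebra. -/
theorem linearIndependent_evalWord {f g : SkewFree L} {d e : ℕ × ℕ} (hf : IsBihomogeneous f d)
    (hg : IsBihomogeneous g e) (hf0 : f ≠ 0) (hg0 : g ≠ 0) (hde : d.1 * e.2 ≠ d.2 * e.1) :
    LinearIndependent L (evalWord f g) := by
  induction hn : d.1 + d.2 + (e.1 + e.2) using Nat.strong_induction_on generalizing f g d e with
  | _ n ih =>
  subst hn
  wlog hed : e.1 + e.2 ≤ d.1 + d.2 generalizing f g d e
  · refine linearIndependent_evalWord_swap (this hg hf hg0 hf0 ?_ ?_ (by omega))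
    · rw [mul_comm e.1, mul_comm e.2]
      exact hde.symm
    · intro m hm f g d e hf hg hf0 hg0 hde hn
      exact ih m (by omega) hf hg hf0 hg0 hde hn
  have hd0 : d ≠ 0 := by
    rintro rfl
    simp at hde
  have he0 : e ≠ 0 := by
    rintro rfl
    simp at hde
  by_cases hfree : ∀ P Q : SkewFree L, P * f + Q * g = 0 → P = 0 ∧ Q = 0
  · exact linearIndependent_evalWord_of_left_free (hf.coeff_one hd0) (hg.coeff_one he0) hfree
  push Not at hfree
  obtain ⟨P, Q, hPQ, hne⟩ := hfree
  obtain ⟨c, rfl, hc⟩ := exists_left_factor hf.length hg.length hed hg0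
    (by by_cases hP : P = 0
        · exact Or.inr (hne hP)
        · exact Or.inl hP) hPQ
  have hcdeg : ∀ w, c.coeff w ≠ 0 → bideg w + e = d := fun w hw => by
    obtain ⟨s, hs, hs'⟩ := hc w hw
    rw [← hf _ hs, bideg_mul, hg s hs']
  have hc0 : c ≠ 0 := by
    rintro rfl
    simp at hf0
  obtain ⟨w₀, hw₀⟩ := exists_coeff_ne_zero hc0
  have hd := hcdeg w₀ hw₀
  have hchom : IsBihomogeneous c (bideg w₀) := fun w hw =>
    add_right_cancel ((hcdeg w hw).trans hd.symm)
  have hepos : 0 < e.1 + e.2 := by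
    by_contra h
    exact he0 (Prod.ext (by simp; omega) (by simp; omega))
  -- Euclidean step: replacing d by d - e keeps the determinant d₁e₂ - d₂e₁ and lowers the total
  -- degree, as e ≠ 0.
  apply linearIndependent_evalWord_mul
  refine ih _ ?_ hchom hg hc0 hg0 ?_ rfl
  · rw [← hd, Prod.fst_add, Prod.snd_add]
    omega
  · rw [← hd, Prod.fst_add, Prod.snd_add] at hde
    intro h
    apply hde
    rw [add_mul, add_mul, h, mul_comm e.1]

end SkewFree

/-! ### Leading forms -/

section Leading

variable {L Γ : Type*} [Field L] [LinearOrder Γ]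

/-- `s'` is homogeneous of degree `D` and all words of `s - s'` have degree less than `D`. -/
structure IsLeading (deg : FreeMonoid (Fin 2) → Γ) (s s' : SkewFree L) (D : Γ) : Prop where
  deg_eq : ∀ w, s'.coeff w ≠ 0 → deg w = D
  deg_lt : ∀ w, s.coeff w ≠ s'.coeff w → deg w < D

variable {deg : FreeMonoid (Fin 2) → Γ}

lemma IsLeading.deg_le {s s' : SkewFree L} {D : Γ} (h : IsLeading deg s s' D)
    (w : FreeMonoid (Fin 2)) (hw : s.coeff w ≠ 0) : deg w ≤ D := by
  by_cases h' : s.coeff w = s'.coeff w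
  · exact (h.deg_eq w (h' ▸ hw)).le
  · exact (h.deg_lt w h').le

lemma exists_isLeading {f : SkewFree L} (hf : f ≠ 0) :
    ∃ (w : FreeMonoid (Fin 2)) (f' : SkewFree L), f.coeff w ≠ 0 ∧ f' ≠ 0 ∧
      IsLeading deg f f' (deg w) := by
  classical
  have hne : f.coeff.support.Nonempty := by
    obtain ⟨w, hw⟩ := exists_coeff_ne_zero hf
    exact ⟨w, Finsupp.mem_support_iff.2 hw⟩
  obtain ⟨w, hw, hmax⟩ := f.coeff.support.exists_max_image deg hne
  have hw' := Finsupp.mem_support_iff.1 hw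
  refine ⟨w, ⟨f.coeff.filter fun v => deg v = deg w⟩, hw', fun h0 => hw' ?_, ⟨?_, ?_⟩⟩
  · have := congrArg (fun s : SkewFree L => s.coeff w) h0
    simpa [Finsupp.filter_apply] using this
  · intro v hv
    by_contra hcon
    exact hv (Finsupp.filter_apply_neg _ _ hcon)
  · intro v hv
    simp only [Finsupp.filter_apply] at hv
    split_ifs at hv with hvw
    · exact absurd rfl hv
    · exact lt_of_le_of_ne (hmax v (Finsupp.mem_support_iff.2 hv)) hvw

variable [AddCommMonoid Γ]

lemma isLeading_single_one (hone : deg 1 = 0) (a : L) :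
    IsLeading deg (SkewMonoidAlgebra.single 1 a) (SkewMonoidAlgebra.single 1 a) 0 where
  deg_eq w hw := by
    classical
    rw [SkewMonoidAlgebra.coeff_single_apply] at hw
    rw [← hone]
    by_contra h
    exact hw (if_neg fun e => h (congrArg deg e.symm))
  deg_lt w hw := absurd rfl hw

end Leading

/-! ### Evaluating K⟨x,y,z⟩ in the skew free algebra -/

section Eval

variable {K L : Type*} [Field K] [Field L] [Algebra K L]
  [MulSemiringAction (FreeMonoid (Fin 2)) L] [SMulCommClass (FreeMonoid (Fin 2)) K L]

lemma lift_apply_eq_sum (F : Fin 3 → SkewFree L) (H : FreeAlg3 K) :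
    FreeAlgebra.lift K F H =
      ∑ M ∈ monomials H, (FreeAlgebra.equivMonoidAlgebraFreeMonoid H).coeff M •
        FreeMonoid.lift F M := by
  have e : FreeAlgebra.lift K F = (MonoidAlgebra.lift K (SkewFree L) _ (FreeMonoid.lift F)).comp
      (FreeAlgebra.equivMonoidAlgebraFreeMonoid (R := K) (X := Fin 3)).toAlgHom := by
    ext i
    simp [FreeAlgebra.equivMonoidAlgebraFreeMonoid]
  rw [e]
  exact MonoidAlgebra.lift_apply _ _

/-! ### Monomials in three letters as pairs of a commutative monomial and a word -/

/-- The pair of a commutative monomial in the shifted variables and of a word in two letters that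
belongs to a word in three letters, if the first two letters shift the variables by `d`
and by `e`. -/
noncomputable def code (d e : ℕ) : List (Fin 3) → (ℕ →₀ ℕ) × FreeMonoid (Fin 2)
  | [] => (0, 1)
  | i :: M => ![((code d e M).1.mapDomain (· + d), FreeMonoid.of 0 * (code d e M).2),
      ((code d e M).1.mapDomain (· + e), FreeMonoid.of 1 * (code d e M).2),
      (Finsupp.single 0 1 + (code d e M).1, (code d e M).2)] i

lemma mapDomain_add_apply_zero {d : ℕ} (hd : 0 < d) (l : ℕ →₀ ℕ) :
    l.mapDomain (· + d) 0 = 0 :=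
  Finsupp.mapDomain_of_notMem_range _ _ fun ⟨i, hi⟩ => by
    simp only at hi
    omega

lemma mapDomain_add_injective (d : ℕ) :
    Function.Injective (Finsupp.mapDomain (M := ℕ) (· + d : ℕ → ℕ)) :=
  Finsupp.mapDomain_injective (add_left_injective d)

lemma of_mul_ne_one {α : Type*} (i : α) (w : FreeMonoid α) : FreeMonoid.of i * w ≠ 1 := fun h => by
  have := congrArg FreeMonoid.length h
  simp [FreeMonoid.length_mul] at this

lemma of_mul_inj {α : Type*} {i j : α} {v w : FreeMonoid α}
    (h : FreeMonoid.of i * v = FreeMonoid.of j * w) : i = j ∧ v = w :=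
  List.cons_eq_cons.1 h

/-- A leading z is visible as a factor t₀, which x and y cannot produce since they shift all indices
by a positive amount. Otherwise the first letter of the word tells x from y. -/
lemma code_injective {d e : ℕ} (hd : 0 < d) (he : 0 < e) : Function.Injective (code d e) := by
  intro M
  induction M with
  | nil =>
    intro N h
    cases N with
    | nil => rfl
    | cons j N =>
      exfalso
      fin_cases j
      · exact of_mul_ne_one _ _ (congrArg Prod.snd h).symm
      · exact of_mul_ne_one _ _ (congrArg Prod.snd h).symm
      · have := DFunLike.congr_fun (congrArg Prod.fst h) 0
        simp [code] at this
        omega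
  | cons i M ih =>
    intro N h
    cases N with
    | nil =>
      exfalso
      fin_cases i
      · exact of_mul_ne_one _ _ (congrArg Prod.snd h)
      · exact of_mul_ne_one _ _ (congrArg Prod.snd h)
      · have := DFunLike.congr_fun (congrArg Prod.fst h) 0
        simp [code] at this
    | cons j N =>
      have h1 := congrArg Prod.fst h
      have h2 := congrArg Prod.snd h
      have h0 := DFunLike.congr_fun h1 0
      fin_cases i <;> fin_cases j
      · exact congrArg _ (ih (Prod.ext (mapDomain_add_injective d h1) (of_mul_inj h2).2))
      · exact absurd (of_mul_inj h2).1 (by decide)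
      · simp [code, mapDomain_add_apply_zero hd] at h0
        omega
      · exact absurd (of_mul_inj h2).1 (by decide)
      · exact congrArg _ (ih (Prod.ext (mapDomain_add_injective e h1) (of_mul_inj h2).2))
      · simp [code, mapDomain_add_apply_zero he] at h0
        omega
      · simp [code, mapDomain_add_apply_zero hd] at h0
      · simp [code, mapDomain_add_apply_zero he] at h0
      · exact congrArg _ (ih (Prod.ext (add_left_cancel h1) h2))

variable {t : ℕ → L}

lemma word_smul_aeval (ht : ∀ (w : FreeMonoid (Fin 2)) i, w • t i = t (i + w.length))
    (w : FreeMonoid (Fin 2)) (p : MvPolynomial ℕ K) :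
    w • MvPolynomial.aeval t p =
      MvPolynomial.aeval t (MvPolynomial.rename (· + w.length) p) := by
  induction p using MvPolynomial.induction_on with
  | C a => simp
  | add p q hp hq => simp [smul_add, hp, hq]
  | mul_X p i hp => simp [smul_mul', hp, ht]

lemma single_one_mul (a : L) (s : SkewFree L) : SkewMonoidAlgebra.single 1 a * s = a • s :=
  SkewMonoidAlgebra.ext fun w => by
    rw [SkewMonoidAlgebra.coeff_single_one_mul, SkewMonoidAlgebra.coeff_smul, Finsupp.smul_apply,
      smul_eq_mul]

/-- Words of equal length shift the variables alike, so a scalar on which they agree moves across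
the whole homogeneous element. -/
lemma mul_smul_of_length {f : SkewFree L} {n : ℕ} (hf : ∀ w, f.coeff w ≠ 0 → w.length = n)
    {a a' : L} (h : ∀ w : FreeMonoid (Fin 2), w.length = n → w • a = a') (s : SkewFree L) :
    f * a • s = a' • (f * s) := by
  rw [← single_one_mul, ← mul_assoc, ← single_one_mul, ← mul_assoc]
  congr 1
  refine SkewMonoidAlgebra.ext fun w => ?_
  rw [SkewMonoidAlgebra.coeff_mul_single_one, SkewMonoidAlgebra.coeff_single_one_mul]
  by_cases hw : f.coeff w = 0
  · simp [hw]
  · rw [h w (hf w hw), mul_comm]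

/-- The images of the generators under the homomorphism `x ↦ f`, `y ↦ g`, `z ↦ t₀`. -/
noncomputable abbrev letters (t : ℕ → L) (f g : SkewFree L) : Fin 3 → SkewFree L :=
  ![f, g, SkewMonoidAlgebra.single 1 (t 0)]

lemma lift_letters_eq_smul (K : Type*) [Field K] [Algebra K L]
    [SMulCommClass (FreeMonoid (Fin 2)) K L]
    (ht : ∀ (w : FreeMonoid (Fin 2)) i, w • t i = t (i + w.length))
    {f g : SkewFree L} {d e : ℕ} (hf : ∀ w, f.coeff w ≠ 0 → w.length = d)
    (hg : ∀ w, g.coeff w ≠ 0 → w.length = e) (M : FreeMonoid (Fin 3)) :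
    FreeMonoid.lift (letters t f g) M =
      MvPolynomial.aeval t (MvPolynomial.monomial (code d e M.toList).1 (1 : K)) •
        evalWord f g (code d e M.toList).2 := by
  have hshift : ∀ (n : ℕ) (m : ℕ →₀ ℕ) (w : FreeMonoid (Fin 2)), w.length = n →
      w • MvPolynomial.aeval t (MvPolynomial.monomial m (1 : K)) =
        MvPolynomial.aeval t (MvPolynomial.monomial (m.mapDomain (· + n)) (1 : K)) := by
    rintro n m w rfl
    rw [word_smul_aeval ht, MvPolynomial.rename_monomial]
  induction M using FreeMonoid.inductionOn' with
  | one => simp [code]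
  | of_mul i M ih =>
    rw [map_mul, FreeMonoid.lift_eval_of, ih]
    fin_cases i
    · refine (mul_smul_of_length hf (hshift d _) _).trans ?_
      change _ = _ • evalWord f g (FreeMonoid.of 0 * (code d e M.toList).2)
      rw [map_mul (evalWord f g), FreeMonoid.lift_eval_of]
      rfl
    · refine (mul_smul_of_length hg (hshift e _) _).trans ?_
      change _ = _ • evalWord f g (FreeMonoid.of 1 * (code d e M.toList).2)
      rw [map_mul (evalWord f g), FreeMonoid.lift_eval_of]
      rfl
    · refine (single_one_mul _ _).trans ?_
      change _ = MvPolynomial.aeval t (MvPolynomial.monomial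
        (Finsupp.single 0 1 + (code d e M.toList).1) (1 : K)) •
          evalWord f g (code d e M.toList).2
      have hX : MvPolynomial.monomial (Finsupp.single 0 1 + (code d e M.toList).1) (1 : K) =
          MvPolynomial.X 0 * MvPolynomial.monomial (code d e M.toList).1 1 := by
        rw [MvPolynomial.X, MvPolynomial.monomial_mul, one_mul]
      rw [smul_smul, hX, map_mul, MvPolynomial.aeval_X]

/-- Bihomogeneous elements with non-proportional bidegrees generate, together with `t₀`,
a free algebra over `K`. -/
theorem linearIndependent_lift_letters (htK : AlgebraicIndependent K t)
    (ht : ∀ (w : FreeMonoid (Fin 2)) i, w • t i = t (i + w.length))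
    {f g : SkewFree L} {d e : ℕ × ℕ} (hf : IsBihomogeneous f d)
    (hg : IsBihomogeneous g e) (hf0 : f ≠ 0) (hg0 : g ≠ 0) (hde : d.1 * e.2 ≠ d.2 * e.1) :
    LinearIndependent K (FreeMonoid.lift (letters t f g)) := by
  have hd : 0 < d.1 + d.2 := by
    by_contra h
    apply hde
    rw [show d.1 = 0 by omega, show d.2 = 0 by omega, zero_mul, zero_mul]
  have he : 0 < e.1 + e.2 := by
    by_contra h
    apply hde
    rw [show e.1 = 0 by omega, show e.2 = 0 by omega, mul_zero, mul_zero]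
  have hb : LinearIndependent K fun m : ℕ →₀ ℕ =>
      MvPolynomial.aeval t (MvPolynomial.monomial m (1 : K)) := by
    have := (MvPolynomial.basisMonomials ℕ K).linearIndependent.map'
      (MvPolynomial.aeval t).toLinearMap (LinearMap.ker_eq_bot.2 htK)
    rwa [MvPolynomial.coe_basisMonomials] at this
  -- Monomials in t are independent over K and words in f, g over L, so their products are
  -- independent over K.
  have := (linearIndependent_smul hb (linearIndependent_evalWord hf hg hf0 hg0 hde)).comp
    (fun M : FreeMonoid (Fin 3) => code (d.1 + d.2) (e.1 + e.2) M.toList)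
    ((code_injective hd he).comp FreeMonoid.toList.injective)
  convert! this using 1
  funext M
  exact lift_letters_eq_smul K ht hf.length hg.length M

/-! ### Leading forms of products and of polynomial values -/

section Leading

variable {Γ : Type*} [AddCommMonoid Γ] [LinearOrder Γ] [IsOrderedCancelAddMonoid Γ]
  {deg : FreeMonoid (Fin 2) → Γ}

lemma IsLeading.mul (hdeg : ∀ v w, deg (v * w) = deg v + deg w) {s s' u u' : SkewFree L} {D E : Γ}
    (h : IsLeading deg s s' D) (k : IsLeading deg u u' E) :
    IsLeading deg (s * u) (s' * u') (D + E) where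
  deg_eq w hw := by
    obtain ⟨a, b, ha, hb, rfl⟩ := exists_of_coeff_mul_ne_zero hw
    rw [hdeg, h.deg_eq a ha, k.deg_eq b hb]
  deg_lt w hw := by
    have e : s * u = (s - s') * u + s' * (u - u') + s' * u' := by noncomm_ring
    have hne : ((s - s') * u).coeff w ≠ 0 ∨ (s' * (u - u')).coeff w ≠ 0 := by
      by_contra! hcon
      apply hw
      rw [e, SkewMonoidAlgebra.coeff_add, SkewMonoidAlgebra.coeff_add, Finsupp.add_apply,
        Finsupp.add_apply, hcon.1, hcon.2, add_zero, zero_add]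
    rcases hne with hne | hne
    · obtain ⟨a, b, ha, hb, rfl⟩ := exists_of_coeff_mul_ne_zero hne
      rw [SkewMonoidAlgebra.coeff_sub, Finsupp.sub_apply, sub_ne_zero] at ha
      rw [hdeg]
      exact add_lt_add_of_lt_of_le (h.deg_lt a ha) (k.deg_le b hb)
    · obtain ⟨a, b, ha, hb, rfl⟩ := exists_of_coeff_mul_ne_zero hne
      rw [SkewMonoidAlgebra.coeff_sub, Finsupp.sub_apply, sub_ne_zero] at hb
      rw [hdeg]
      exact add_lt_add_of_le_of_lt (h.deg_eq a ha).le (k.deg_lt b hb)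

lemma isLeading_lift (hone : deg 1 = 0) (hdeg : ∀ v w, deg (v * w) = deg v + deg w)
    {F F' : Fin 3 → SkewFree L} {D : Fin 3 → Γ} (h : ∀ i, IsLeading deg (F i) (F' i) (D i))
    (M : FreeMonoid (Fin 3)) :
    IsLeading deg (FreeMonoid.lift F M) (FreeMonoid.lift F' M) (M.toList.map D).sum := by
  induction M using FreeMonoid.inductionOn' with
  | one => exact isLeading_single_one hone 1
  | of_mul i M ih =>
    rw [map_mul, map_mul, FreeMonoid.lift_eval_of, FreeMonoid.lift_eval_of]
    simpa [FreeMonoid.toList_mul] using (h i).mul hdeg ih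

/-- Taking the coefficient at a word, as an additive map. -/
noncomputable def coeffHom (w : FreeMonoid (Fin 2)) : SkewFree L →+ L where
  toFun s := s.coeff w
  map_zero' := rfl
  map_add' := by simp

/-- If the leading forms of the images of the generators are free, then a homogeneous element in
the image has the degree of a monomial in these images. -/
lemma exists_monomial_degree_eq (hone : deg 1 = 0) (hdeg : ∀ v w, deg (v * w) = deg v + deg w)
    {F F' : Fin 3 → SkewFree L} {D : Fin 3 → Γ} (h : ∀ i, IsLeading deg (F i) (F' i) (D i))
    (hli : LinearIndependent K (FreeMonoid.lift F')) {H : FreeAlg3 K}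
    {w₀ : FreeMonoid (Fin 2)}
    (hH : FreeAlgebra.lift K F H = SkewMonoidAlgebra.single w₀ 1) :
    ∃ M : FreeMonoid (Fin 3), (M.toList.map D).sum = deg w₀ := by
  classical
  let wdeg : FreeMonoid (Fin 3) → Γ := fun M => (M.toList.map D).sum
  set c := (FreeAlgebra.equivMonoidAlgebraFreeMonoid H).coeff with hc
  have hne : (monomials H).Nonempty := by
    rw [Finset.nonempty_iff_ne_empty]
    intro h0
    rw [lift_apply_eq_sum, h0, Finset.sum_empty] at hH
    exact one_ne_zero (SkewMonoidAlgebra.single_eq_zero.1 hH.symm)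
  obtain ⟨M₀, hM₀, hmax⟩ := (monomials H).exists_max_image wdeg hne
  refine ⟨M₀, ?_⟩
  -- The candidate leading form of the image: freeness of the leading forms excludes cancellation
  -- among the monomials of top degree.
  have hT : ∑ M ∈ monomials H with wdeg M = wdeg M₀, c M • FreeMonoid.lift F' M ≠ 0 := fun h0 =>
    Finsupp.mem_support_iff.1 hM₀ (linearIndependent_iff'.1 hli _ _ h0 M₀ (by simp [hM₀]))
  obtain ⟨w, hw⟩ := exists_coeff_ne_zero hT
  have hlead := isLeading_lift hone hdeg h
  have hwD : deg w = wdeg M₀ := by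
    by_contra hwD
    apply hw
    change coeffHom w _ = 0
    rw [map_sum]
    refine Finset.sum_eq_zero fun M hM => ?_
    change (c M • FreeMonoid.lift F' M).coeff w = 0
    rw [SkewMonoidAlgebra.coeff_smul, Finsupp.smul_apply]
    by_contra hMw
    exact hwD (((hlead M).deg_eq w (right_ne_zero_of_smul hMw)).trans (Finset.mem_filter.1 hM).2)
  have heq : (FreeAlgebra.lift K F H).coeff w =
      (∑ M ∈ monomials H with wdeg M = wdeg M₀, c M • FreeMonoid.lift F' M).coeff w := by
    rw [lift_apply_eq_sum, Finset.sum_filter]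
    change coeffHom w _ = coeffHom w _
    rw [map_sum, map_sum]
    refine Finset.sum_congr rfl fun M hM => ?_
    split_ifs with hMD
    · change (c M • _ : SkewFree L).coeff w = (c M • _ : SkewFree L).coeff w
      rw [SkewMonoidAlgebra.coeff_smul, SkewMonoidAlgebra.coeff_smul, Finsupp.smul_apply,
        Finsupp.smul_apply]
      congr 1
      by_contra hcon
      exact ((hlead M).deg_lt w hcon).ne (hwD.trans hMD.symm)
    · change (c M • _ : SkewFree L).coeff w = 0
      rw [SkewMonoidAlgebra.coeff_smul, Finsupp.smul_apply]
      by_contra hcon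
      have := (hlead M).deg_le w (right_ne_zero_of_smul hcon)
      exact hMD (le_antisymm (hmax M hM) (hwD ▸ this))
  rw [← heq, hH, SkewMonoidAlgebra.coeff_single_apply] at hw
  have hww : w₀ = w := by
    by_contra h0
    exact hw (if_neg h0)
  rw [hww, hwD]

end Leading

end Eval

/-! ### The order on bidegrees -/

/-- The bidegree `(p, q)` as an element of `ℤ × ℤ` with the lexicographic order, compared first by
`a q - b p` and then by `p + q`. -/
def slopeDeg (a b : ℕ) : ℕ × ℕ →+ ℤ ×ₗ ℤ where
  toFun p := toLex ((a * p.2 - b * p.1 : ℤ), (p.1 + p.2 : ℤ))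
  map_zero' := by simp
  map_add' p q := by
    apply ofLex.injective
    ext <;> simp <;> ring

/-- The forms aq - bp and p + q have determinant ±(a + b) ≠ 0. Hence leading forms for this order
are bihomogeneous. -/
lemma slopeDeg_injective {a b : ℕ} (hab : (a, b) ≠ 0) : Function.Injective (slopeDeg a b) := by
  intro p q h
  have h' := congrArg ofLex h
  simp only [slopeDeg, AddMonoidHom.coe_mk, ZeroHom.coe_mk, ofLex_toLex, Prod.mk.injEq] at h'
  obtain ⟨h1, h2⟩ := h'
  have hpos : (0 : ℤ) < a + b := by
    by_contra hcon
    exact hab (Prod.ext (by simp; omega) (by simp; omega))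
  have e1 : ((a : ℤ) + b) * (p.2 - q.2) = 0 := by linear_combination h1 + b * h2
  have e2 : (p.2 : ℤ) = q.2 := by
    rcases mul_eq_zero.1 e1 with h | h <;> omega
  exact Prod.ext (by omega) (by omega)

lemma slopeDeg_le_iff {a b : ℕ} {p q : ℕ × ℕ} : slopeDeg a b p ≤ slopeDeg a b q ↔
    (a * p.2 - b * p.1 : ℤ) < a * q.2 - b * q.1 ∨
      (a * p.2 - b * p.1 : ℤ) = a * q.2 - b * q.1 ∧ (p.1 + p.2 : ℤ) ≤ q.1 + q.2 := by
  simp [slopeDeg, Prod.Lex.toLex_le_toLex]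

/-- A finite set of nonzero vectors in the first quadrant has an element of maximal slope. -/
lemma exists_max_slope {Δ : Finset (ℕ × ℕ)} (hne : Δ.Nonempty) (h0 : 0 ∉ Δ) :
    ∃ p ∈ Δ, ∀ q ∈ Δ, p.1 * q.2 ≤ p.2 * q.1 := by
  -- Dividing by q₁ + q₂ rather than q₁ gives the same order and allows vertical vectors.
  obtain ⟨p, hp, hmax⟩ := Δ.exists_max_image (fun q => (q.2 : ℚ) / (q.1 + q.2)) hne
  have hpos : ∀ q ∈ Δ, (0 : ℚ) < q.1 + q.2 := by
    intro q hq
    by_contra hcon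
    have : q.1 + q.2 = 0 := by
      by_contra h
      exact hcon (by exact_mod_cast Nat.pos_of_ne_zero h)
    exact h0 ((Prod.ext (by simp; omega) (by simp; omega) : q = 0) ▸ hq)
  refine ⟨p, hp, fun q hq => ?_⟩
  have := hmax q hq
  rw [div_le_div_iff₀ (hpos q hq) (hpos p hp)] at this
  have h : (p.1 * q.2 : ℚ) ≤ p.2 * q.1 := by linarith
  exact_mod_cast h

lemma exists_degree_eq_nsmul {Γ : Type*} [AddCommMonoid Γ] (D E : Γ) (M : List (Fin 3)) :
    ∃ i j : ℕ, (M.map ![D, E, 0]).sum = i • D + j • E := by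
  induction M with
  | nil => exact ⟨0, 0, by simp⟩
  | cons k M ih =>
    obtain ⟨i, j, h⟩ := ih
    rw [List.map_cons, List.sum_cons, h]
    fin_cases k
    · exact ⟨i + 1, j, by simp [add_smul]; abel⟩
    · exact ⟨i, j + 1, by simp [add_smul]; abel⟩
    · exact ⟨i, j, by simp⟩

/-- A perturbation of the letter of bidegree `p` by words whose bidegrees lie, relative to `p`,
below the line of slope `b / a`: all words of the leading form lie on that line. -/
lemma exists_isLeading_slope {L : Type*} [Field L] {f : SkewFree L}
    {v : FreeMonoid (Fin 2)} {a b : ℕ}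
    (hv : f.coeff v ≠ 0) (hab : (a, b) ≠ 0)
    (h : ∀ w, f.coeff w ≠ 0 → ∃ s : ℕ × ℕ, bideg w = bideg v + s ∧ a * s.2 ≤ b * s.1) :
    ∃ (s : ℕ × ℕ) (f' : SkewFree L), f' ≠ 0 ∧ a * s.2 = b * s.1 ∧
      IsBihomogeneous f' (bideg v + s) ∧
      IsLeading (fun w => slopeDeg a b (bideg w)) f f' (slopeDeg a b (bideg v + s)) ∧
      (∀ w, f.coeff w ≠ 0 → bideg w = bideg v + (a, b) → s ≠ 0) := by
  have hf : f ≠ 0 := by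
    rintro rfl
    exact hv rfl
  obtain ⟨w, f', hw, hf', hlead⟩ := exists_isLeading (deg := fun w => slopeDeg a b (bideg w)) hf
  obtain ⟨s, hs, hsle⟩ := h w hw
  rw [hs] at hlead
  have hle := hlead.deg_le v hv
  simp only [slopeDeg_le_iff, Prod.fst_add, Prod.snd_add] at hle
  push_cast at hle
  have hsle' : (a * s.2 : ℤ) ≤ b * s.1 := by exact_mod_cast hsle
  have hseq : (a * s.2 : ℤ) = b * s.1 := by
    refine le_antisymm hsle' ?_
    rcases hle with hle | ⟨hle, -⟩ <;> linarith
  refine ⟨s, f', hf', by exact_mod_cast hseq, fun u hu => slopeDeg_injective hab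
    (hlead.deg_eq u hu), hlead, fun u hu hub => ?_⟩
  rintro rfl
  -- If s = 0, the word u would have the same first weight as v and larger total degree,
  -- contradicting maximality.
  have hle' := hlead.deg_le u hu
  simp only [slopeDeg_le_iff, hub, Prod.fst_add, Prod.snd_add] at hle'
  push_cast at hle'
  apply hab
  have h3 : a + b = 0 := by
    rcases hle' with h' | ⟨-, h'⟩
    · nlinarith
    · simp at h'; omega
  exact Prod.ext (by simp; omega) (by simp; omega)

lemma coeff_letter_add {L : Type*} [Field L] {i : Fin 2} {U : SkewFree L}
    (hU : ∀ w, U.coeff w ≠ 0 → 0 < (bideg w).1 ∧ 0 < (bideg w).2) :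
    (SkewMonoidAlgebra.single (FreeMonoid.of i) 1 + U : SkewFree L).coeff (FreeMonoid.of i) ≠ 0 ∧
      (∀ w, U.coeff w ≠ 0 →
        (SkewMonoidAlgebra.single (FreeMonoid.of i) 1 + U : SkewFree L).coeff w ≠ 0) ∧
      ∀ w, (SkewMonoidAlgebra.single (FreeMonoid.of i) 1 + U : SkewFree L).coeff w ≠ 0 →
        w = FreeMonoid.of i ∨ U.coeff w ≠ 0 := by
  classical
  have hi : U.coeff (FreeMonoid.of i) = 0 := by
    by_contra h
    have := hU _ h
    fin_cases i <;> simp at this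
  simp only [SkewMonoidAlgebra.coeff_add, Finsupp.add_apply, SkewMonoidAlgebra.coeff_single_apply]
  refine ⟨by simp [hi], fun w hw => ?_, fun w hw => ?_⟩
  · rw [if_neg, zero_add]
    · exact hw
    · rintro rfl
      exact hw hi
  · by_contra! hcon
    rw [hcon.2, if_neg (Ne.symm hcon.1)] at hw
    simp at hw

/-! ### The letters are not both in the image -/

section Main

variable {K L : Type*} [Field K] [Field L] [Algebra K L]
  [MulSemiringAction (FreeMonoid (Fin 2)) L] [SMulCommClass (FreeMonoid (Fin 2)) K L]
  {t : ℕ → L}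

/-- If all words of `U` and `V` contain both letters and `(U, V) ≠ (0, 0)`, then the letters are
not both polynomials in `X + U`, `Y + V`, `t₀`. -/
theorem not_generate (htK : AlgebraicIndependent K t)
    (ht : ∀ (w : FreeMonoid (Fin 2)) i, w • t i = t (i + w.length)) {U V : SkewFree L}
    (hU : ∀ w, U.coeff w ≠ 0 → 0 < (bideg w).1 ∧ 0 < (bideg w).2)
    (hV : ∀ w, V.coeff w ≠ 0 → 0 < (bideg w).1 ∧ 0 < (bideg w).2)
    (hUV : U ≠ 0 ∨ V ≠ 0) {H G : FreeAlg3 K}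
    (hH : FreeAlgebra.lift K (letters t (SkewMonoidAlgebra.single (FreeMonoid.of 0) 1 + U)
      (SkewMonoidAlgebra.single (FreeMonoid.of 1) 1 + V)) H =
        SkewMonoidAlgebra.single (FreeMonoid.of 0) 1)
    (hG : FreeAlgebra.lift K (letters t (SkewMonoidAlgebra.single (FreeMonoid.of 0) 1 + U)
      (SkewMonoidAlgebra.single (FreeMonoid.of 1) 1 + V)) G =
        SkewMonoidAlgebra.single (FreeMonoid.of 1) 1) : False := by
  classical
  obtain ⟨hfX, hfU, hf⟩ := coeff_letter_add (i := 0) hU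
  obtain ⟨hgY, hgV, hg⟩ := coeff_letter_add (i := 1) hV
  set f : SkewFree L := SkewMonoidAlgebra.single (FreeMonoid.of 0) 1 + U
  set g : SkewFree L := SkewMonoidAlgebra.single (FreeMonoid.of 1) 1 + V
  have hshiftU : ∀ w, U.coeff w ≠ 0 →
      bideg w = bideg (FreeMonoid.of 0) + ((bideg w).1 - 1, (bideg w).2) := fun w hw => by
    have := hU w hw
    exact Prod.ext (by simp; omega) (by simp)
  have hshiftV : ∀ w, V.coeff w ≠ 0 →
      bideg w = bideg (FreeMonoid.of 1) + ((bideg w).1, (bideg w).2 - 1) := fun w hw => by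
    have := hV w hw
    exact Prod.ext (by simp) (by simp; omega)
  -- Bidegrees relative to the letter being perturbed. Truncated subtraction is exact, and 0 is
  -- absent, because every word contains both letters.
  let Δ : Finset (ℕ × ℕ) := U.coeff.support.image (fun w => ((bideg w).1 - 1, (bideg w).2)) ∪
    V.coeff.support.image (fun w => ((bideg w).1, (bideg w).2 - 1))
  have hΔU : ∀ w, U.coeff w ≠ 0 → ((bideg w).1 - 1, (bideg w).2) ∈ Δ := fun w hw =>
    Finset.mem_union_left _ (Finset.mem_image_of_mem _ (Finsupp.mem_support_iff.2 hw))
  have hΔV : ∀ w, V.coeff w ≠ 0 → ((bideg w).1, (bideg w).2 - 1) ∈ Δ := fun w hw =>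
    Finset.mem_union_right _ (Finset.mem_image_of_mem _ (Finsupp.mem_support_iff.2 hw))
  have hΔ : ∀ p ∈ Δ, (∃ w, U.coeff w ≠ 0 ∧ ((bideg w).1 - 1, (bideg w).2) = p) ∨
      ∃ w, V.coeff w ≠ 0 ∧ ((bideg w).1, (bideg w).2 - 1) = p := fun p hp => by
    simpa [Δ, -Prod.mk.injEq] using hp
  have hne : Δ.Nonempty := by
    rcases hUV with h | h
    · obtain ⟨w, hw⟩ := exists_coeff_ne_zero h
      exact ⟨_, hΔU w hw⟩
    · obtain ⟨w, hw⟩ := exists_coeff_ne_zero h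
      exact ⟨_, hΔV w hw⟩
  have h0 : (0 : ℕ × ℕ) ∉ Δ := fun hmem => by
    rcases hΔ 0 hmem with ⟨w, hw, he⟩ | ⟨w, hw, he⟩
    · exact (hU w hw).2.ne' (congrArg Prod.snd he)
    · exact (hV w hw).1.ne' (congrArg Prod.fst he)
  obtain ⟨⟨a, b⟩, habΔ, hmax⟩ := exists_max_slope hne h0
  have hab : (a, b) ≠ 0 := fun h => h0 (h ▸ habΔ)
  obtain ⟨s, f', hf', hs, hfhom, hflead, hsne⟩ := exists_isLeading_slope hfX hab fun w hw => by
    rcases hf w hw with rfl | hw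
    · exact ⟨0, by simp⟩
    · exact ⟨_, hshiftU w hw, hmax _ (hΔU w hw)⟩
  obtain ⟨r, g', hg', hr, hghom, hglead, hrne⟩ := exists_isLeading_slope hgY hab fun w hw => by
    rcases hg w hw with rfl | hw
    · exact ⟨0, by simp⟩
    · exact ⟨_, hshiftV w hw, hmax _ (hΔV w hw)⟩
  have hsr : s ≠ 0 ∨ r ≠ 0 := by
    rcases hΔ _ habΔ with ⟨w, hw, he⟩ | ⟨w, hw, he⟩
    · exact Or.inl (hsne w (hfU w hw) (he ▸ hshiftU w hw))
    · exact Or.inr (hrne w (hgV w hw) (he ▸ hshiftV w hw))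
  have hpar : s.1 * r.2 = s.2 * r.1 := by
    by_cases ha : a = 0
    · subst ha
      have hb : b ≠ 0 := fun hb => hab (by rw [hb]; rfl)
      have hs1 : s.1 = 0 := by simpa [hb] using hs
      have hr1 : r.1 = 0 := by simpa [hb] using hr
      rw [hs1, hr1, zero_mul, mul_zero]
    · apply Nat.eq_of_mul_eq_mul_left (Nat.pos_of_ne_zero ha)
      linear_combination s.1 * hr - r.1 * hs
  have hli : LinearIndependent K (FreeMonoid.lift (letters t f' g')) := by
    refine linearIndependent_lift_letters htK ht hfhom hghom hf' hg' ?_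
    simp only [bideg_of_zero, bideg_of_one, Prod.fst_add, Prod.snd_add, zero_add]
    -- The determinant is 1 + s₁ + r₂ + (s₁r₂ - s₂r₁), and the bracket vanishes by `hpar`.
    intro h
    have : 1 + s.1 + r.2 = 0 := by linear_combination h - hpar
    omega
  have hlead : ∀ i, IsLeading (fun w => slopeDeg a b (bideg w)) (letters t f g i)
      (letters t f' g' i) (![slopeDeg a b (bideg (FreeMonoid.of 0) + s),
        slopeDeg a b (bideg (FreeMonoid.of 1) + r), 0] i) := by
    intro i
    fin_cases i
    · exact hflead
    · exact hglead
    · exact isLeading_single_one (by simp) _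
  have key : ∀ {w₀ : FreeMonoid (Fin 2)} {H : FreeAlg3 K},
      FreeAlgebra.lift K (letters t f g) H = SkewMonoidAlgebra.single w₀ 1 →
      ∃ i j : ℕ, i • (bideg (FreeMonoid.of 0) + s) + j • (bideg (FreeMonoid.of 1) + r) =
        bideg w₀ := by
    intro w₀ H hH
    obtain ⟨M, hM⟩ := exists_monomial_degree_eq (by simp) (by simp) hlead hli hH
    obtain ⟨i, j, hij⟩ := exists_degree_eq_nsmul (slopeDeg a b (bideg (FreeMonoid.of 0) + s))
      (slopeDeg a b (bideg (FreeMonoid.of 1) + r)) M.toList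
    refine ⟨i, j, slopeDeg_injective hab ?_⟩
    rw [map_add, map_nsmul, map_nsmul, ← hij, hM]
  obtain ⟨i, j, hij⟩ := key hH
  obtain ⟨k, l, hkl⟩ := key hG
  have h1 := congrArg Prod.fst hij
  have h2 := congrArg Prod.snd hij
  have h3 := congrArg Prod.fst hkl
  have h4 := congrArg Prod.snd hkl
  simp only [bideg_of_zero, bideg_of_one, Prod.fst_add, Prod.snd_add, Prod.smul_fst, Prod.smul_snd,
    smul_eq_mul, zero_add, Nat.add_eq_zero_iff, mul_eq_zero] at h1 h2 h3 h4
  -- The second coordinate of X is 0, while the bidegree attached to g has second coordinate 1 + r₂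
  -- > 0; symmetrically for Y.
  have hj : j = 0 := by omega
  have hk : k = 0 := by omega
  subst hj hk
  rw [zero_mul, add_zero, mul_eq_one] at h1
  rw [zero_mul, zero_add, mul_eq_one] at h4
  rcases hsr with h | h
  · exact h (Prod.ext (by simp; omega) (by simp; omega))
  · exact h (Prod.ext (by simp; omega) (by simp; omega))

lemma bideg_eq_count {M : FreeMonoid (Fin 3)} {w : FreeMonoid (Fin 2)}
    (hw : (FreeMonoid.lift (letters t (SkewMonoidAlgebra.single (FreeMonoid.of 0) 1)
      (SkewMonoidAlgebra.single (FreeMonoid.of 1) 1)) M : SkewFree L).coeff w ≠ 0) :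
    bideg w = (M.toList.count 0, M.toList.count 1) := by
  classical
  have hsingle : ∀ {v w : FreeMonoid (Fin 2)} {a : L},
      (SkewMonoidAlgebra.single v a : SkewFree L).coeff w ≠ 0 → w = v := by
    intro v w a h
    rw [SkewMonoidAlgebra.coeff_single_apply] at h
    by_contra hne
    exact h (if_neg (Ne.symm hne))
  induction M using FreeMonoid.inductionOn' generalizing w with
  | one =>
    rw [map_one, SkewMonoidAlgebra.one_def] at hw
    rw [hsingle hw]
    rfl
  | of_mul i M ih =>
    rw [map_mul, FreeMonoid.lift_eval_of] at hw
    obtain ⟨v, w', hv, hw', rfl⟩ := exists_of_coeff_mul_ne_zero hw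
    rw [bideg_mul, ih hw']
    fin_cases i
    · rw [hsingle hv]
      simp [FreeMonoid.toList_mul, add_comm]
    · rw [hsingle hv]
      simp [FreeMonoid.toList_mul, add_comm]
    · rw [hsingle hv]
      simp [FreeMonoid.toList_mul]

lemma bideg_pos_of_monomialsInvolveXY {u : FreeAlg3 K} (hu : MonomialsInvolveXY u)
    {w : FreeMonoid (Fin 2)}
    (hw : (FreeAlgebra.lift K (letters t (SkewMonoidAlgebra.single (FreeMonoid.of 0) 1)
      (SkewMonoidAlgebra.single (FreeMonoid.of 1) 1)) u : SkewFree L).coeff w ≠ 0) :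
    0 < (bideg w).1 ∧ 0 < (bideg w).2 := by
  rw [lift_apply_eq_sum] at hw
  change coeffHom w _ ≠ 0 at hw
  rw [map_sum] at hw
  obtain ⟨M, hM, hMw⟩ := Finset.exists_ne_zero_of_sum_ne_zero hw
  change ((FreeAlgebra.equivMonoidAlgebraFreeMonoid u).coeff M • _ : SkewFree L).coeff w ≠ 0 at hMw
  rw [SkewMonoidAlgebra.coeff_smul, Finsupp.smul_apply] at hMw
  rw [bideg_eq_count (right_ne_zero_of_smul hMw)]
  exact ⟨List.count_pos_iff.2 (hu M hM).1, List.count_pos_iff.2 (hu M hM).2⟩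

lemma lift_letters_ne_zero (htK : AlgebraicIndependent K t)
    (ht : ∀ (w : FreeMonoid (Fin 2)) i, w • t i = t (i + w.length)) {u : FreeAlg3 K}
    (hu : u ≠ 0) :
    FreeAlgebra.lift K (letters t (SkewMonoidAlgebra.single (FreeMonoid.of 0) 1)
      (SkewMonoidAlgebra.single (FreeMonoid.of 1) 1)) u ≠ 0 := by
  classical
  have hhom : ∀ i : Fin 2, IsBihomogeneous (SkewMonoidAlgebra.single (FreeMonoid.of i) (1 : L))
      (bideg (FreeMonoid.of i)) := by
    intro i w hw
    rw [SkewMonoidAlgebra.coeff_single_apply] at hw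
    by_contra h
    exact hw (if_neg fun e => h (congrArg bideg e.symm))
  have hne : ∀ i : Fin 2, (SkewMonoidAlgebra.single (FreeMonoid.of i) (1 : L) : SkewFree L) ≠ 0 :=
    fun i h => one_ne_zero (SkewMonoidAlgebra.single_eq_zero.1 h)
  have hli := linearIndependent_lift_letters htK ht (hhom 0) (hhom 1) (hne 0) (hne 1) (by simp)
  intro h
  apply hu
  rw [lift_apply_eq_sum] at h
  have h0 := linearIndependent_iff'.1 hli _ _ h
  apply (FreeAlgebra.equivMonoidAlgebraFreeMonoid (R := K) (X := Fin 3)).injective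
  rw [map_zero]
  ext M
  by_contra hM
  exact hM (h0 M (Finsupp.mem_support_iff.2 hM))

end Main

/-! ### A field with a shift -/

/-- The rational function field in `t₀, t₁, …` with its shift. -/
lemma exists_shift_field.{u} (K : Type u) [Field K] :
    ∃ (L : Type u) (_ : Field L) (_ : Algebra K L) (t : ℕ → L) (σ : L →ₐ[K] L),
      AlgebraicIndependent K t ∧ ∀ i, σ (t i) = t (i + 1) := by
  let R := MvPolynomial ℕ K
  let L := FractionRing R
  let j : R →ₐ[K] L := IsScalarTower.toAlgHom K R L
  have hj : Function.Injective j := IsFractionRing.injective R L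
  have hσ : Function.Injective (j.comp (MvPolynomial.rename (· + 1))) :=
    hj.comp (MvPolynomial.rename_injective _ (add_left_injective 1))
  refine ⟨L, inferInstance, inferInstance, fun i => j (MvPolynomial.X i),
    IsFractionRing.liftAlgHom hσ, ?_, fun i => ?_⟩
  · have e : MvPolynomial.aeval (fun i => j (MvPolynomial.X i)) = j := by
      ext i
      simp
    rw [AlgebraicIndependent, e]
    exact hj
  · refine (IsFractionRing.lift_algebraMap hσ (MvPolynomial.X i)).trans ?_
    exact congrArg j (MvPolynomial.rename_X _ _)

lemma exists_word_action.{u} (K : Type u) [Field K] :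
    ∃ (L : Type u) (_ : Field L) (_ : Algebra K L) (_ : MulSemiringAction (FreeMonoid (Fin 2)) L)
      (_ : SMulCommClass (FreeMonoid (Fin 2)) K L) (t : ℕ → L), AlgebraicIndependent K t ∧
        ∀ (w : FreeMonoid (Fin 2)) i, w • t i = t (i + w.length) := by
  obtain ⟨L, hL, hKL, t, σ, htK, hσ⟩ := exists_shift_field K
  -- Both letters act by the same σ, so a word acts through its length only. σ need not be
  -- invertible.
  let act : MulSemiringAction (FreeMonoid (Fin 2)) L :=
    MulSemiringAction.compHom L (FreeMonoid.lift fun _ : Fin 2 => (σ : L →+* L))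
  have hof : ∀ (i : Fin 2) (a : L), FreeMonoid.of i • a = σ a := fun i a => by
    change (FreeMonoid.lift (fun _ : Fin 2 => (σ : L →+* L)) (FreeMonoid.of i)) a = σ a
    rw [FreeMonoid.lift_eval_of]
    rfl
  refine ⟨L, hL, hKL, act, ⟨fun w k a => ?_⟩, t, htK, fun w i => ?_⟩
  · induction w using FreeMonoid.inductionOn' with
    | one => simp
    | of_mul i w ih => rw [mul_smul, mul_smul, ih, hof, hof, map_smul]
  · induction w using FreeMonoid.inductionOn' with
    | one => simp
    | of_mul j w ih =>
      rw [mul_smul, ih, hof, hσ, FreeMonoid.length_mul, FreeMonoid.length_of]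
      congr 1
      omega

end FreeAlg3

theorem mainTheorem8 {K : Type*} [Field K] (u v : FreeAlg3 K)
    (huv : (u, v) ≠ (0, 0))
    (hu : FreeAlg3.MonomialsInvolveXY u) (hv : FreeAlg3.MonomialsInvolveXY v) :
    ¬ FreeAlg3.IsAutomorphism (FreeAlg3.zEndo (FreeAlg3.x K + u) (FreeAlg3.y K + v)) := by
  rintro ⟨e, he⟩
  obtain ⟨L, _, _, _, _, t, htK, ht⟩ := FreeAlg3.exists_word_action K
  set Φ : FreeAlg3 K →ₐ[K] FreeAlg3.SkewFree L :=
    FreeAlgebra.lift K (FreeAlg3.letters t (SkewMonoidAlgebra.single (FreeMonoid.of 0) 1)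
      (SkewMonoidAlgebra.single (FreeMonoid.of 1) 1)) with hΦ
  have hx : Φ (FreeAlg3.x K) = SkewMonoidAlgebra.single (FreeMonoid.of 0) 1 :=
    FreeAlgebra.lift_ι_apply _ _
  have hy : Φ (FreeAlg3.y K) = SkewMonoidAlgebra.single (FreeMonoid.of 1) 1 :=
    FreeAlgebra.lift_ι_apply _ _
  have hz : Φ (FreeAlg3.z K) = SkewMonoidAlgebra.single 1 (t 0) :=
    FreeAlgebra.lift_ι_apply _ _
  have hcomp : Φ.comp (FreeAlg3.zEndo (FreeAlg3.x K + u) (FreeAlg3.y K + v)) =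
      FreeAlgebra.lift K (FreeAlg3.letters t
        (SkewMonoidAlgebra.single (FreeMonoid.of 0) 1 + Φ u)
        (SkewMonoidAlgebra.single (FreeMonoid.of 1) 1 + Φ v)) := by
    ext i
    fin_cases i <;> simp [FreeAlg3.zEndo, hx, hy, hz]
  -- Preimages of x and y under the supposed automorphism write X and Y as polynomials in X + Φ u, Y
  -- + Φ v, t₀.
  have hpre : ∀ H, FreeAlgebra.lift K (FreeAlg3.letters t
      (SkewMonoidAlgebra.single (FreeMonoid.of 0) 1 + Φ u)
      (SkewMonoidAlgebra.single (FreeMonoid.of 1) 1 + Φ v)) (e.symm H) = Φ H := fun H => by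
    rw [← hcomp, ← he]
    simp
  refine FreeAlg3.not_generate htK ht
    (fun w hw => FreeAlg3.bideg_pos_of_monomialsInvolveXY hu hw)
    (fun w hw => FreeAlg3.bideg_pos_of_monomialsInvolveXY hv hw) ?_
    ((hpre (FreeAlg3.x K)).trans hx) ((hpre (FreeAlg3.y K)).trans hy)
  by_cases h : u = 0
  · exact Or.inr (FreeAlg3.lift_letters_ne_zero htK ht fun h' => huv (by rw [h, h']))
  · exact Or.inl (FreeAlg3.lift_letters_ne_zero htK ht h)
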